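/- Let $\mathfrak C=\{0,1\}^{\mathbb N}$ be the Cantor set. For a natural number $n$, a pattern is a dissection of $\mathfrak C^n$ into finitely many rectangles obtained from $\mathfrak C^n$ by repeatedly cutting a rectangle in half across one of the $n$ dimensions; each rectangle is a product $R=w_1\mathfrak C\times\dots\times w_n\mathfrak C$ of cones, with $w_1,\dots,w_n$ finite binary words. The higher dimensional Thompson group $nV$ is the group of all self-homeomorphisms $f$ of $\mathfrak C^n$ for which there are two patterns and a bijection $R\mapsto R'$ between their rectangles such that $f$ maps each $R$ onto $R'$ by prefix replacement in every coordinate, $(w_1x_1,\dots,w_nx_n)\mapsto(w_1'x_1,\dots,w_n'x_n)$. Letting $nV$ act on the first $n$ coordinates of $\mathfrak C^{\mathbb N}$ and trivially on the other ones, one has $1V\subseteq 2V\subseteq 3V\subseteq\cdots$, and $\omega V$ is the union of these groups. Theorem. For every $n\le\omega$ (that is, for every natural number $n$ and for $n=\omega$) the group $nV$ is perfect, i.e. equal to its commutator subgroup. -/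

import Mathlib

namespace HigherThompson

/-- The power `𝔠^ι` of the Cantor set `𝔠 = {0,1}^ℕ`, with the product topology. -/
abbrev CantorPower (ι : Type) : Type := ι → ℕ → Bool

/-- The infinite word `w x` obtained by writing the finite word `w` in front of `x`. -/
def prepend : List Bool → (ℕ → Bool) → (ℕ → Bool)
  | [], x => x
  | b :: w, x => fun k => Nat.casesOn k b (prepend w x)

/-- A dyadic rectangle is given by one finite binary word in each dimension; it is the range of
the canonical (coordinatewise affine, order preserving) map `place w` from the whole of `𝔠^ι`
onto it. -/
def place {ι : Type} (w : ι → List Bool) (x : CantorPower ι) : CantorPower ι :=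
  fun i => prepend (w i) (x i)

/-- Patterns: dissections of the unit cube obtained by repeatedly cutting rectangles in half.
`unit` is the undivided cube; `cut d P Q` first cuts the cube in half across dimension `d`, then
applies `P` to the lower half and `Q` to the upper half. -/
inductive Pattern (ι : Type) : Type
  | unit : Pattern ι
  | cut (d : ι) (P Q : Pattern ι) : Pattern ι

namespace Pattern

/-- The (labels of the) rectangles of a pattern. -/
def Piece {ι : Type} : Pattern ι → Type
  | unit => Unit
  | cut _ P Q => P.Piece ⊕ Q.Piece

/-- The words that describe the rectangle with a given label. -/
def addr {ι : Type} [DecidableEq ι] : (P : Pattern ι) → P.Piece → ι → List Bool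
  | unit, _ => fun _ => []
  | cut d P _, Sum.inl p => Function.update (P.addr p) d (false :: P.addr p d)
  | cut d _ Q, Sum.inr q => Function.update (Q.addr q) d (true :: Q.addr q d)

end Pattern

/-- `f` is the map given by a pair of numbered patterns: there are two patterns and a bijection
`e` between their rectangles such that `f` carries each rectangle `p` of the first pattern onto
the rectangle `e p` of the second one by the canonical map. -/
def IsPatternMap {ι : Type} [DecidableEq ι] (f : CantorPower ι → CantorPower ι) : Prop :=
  ∃ (P Q : Pattern ι) (e : P.Piece ≃ Q.Piece),
    ∀ (p : P.Piece) (x : CantorPower ι), f (place (P.addr p) x) = place (Q.addr (e p)) x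

/-! Facts needed to see that the pattern maps form a group. -/

theorem prepend_append (u v : List Bool) (x : ℕ → Bool) :
    prepend (u ++ v) x = prepend u (prepend v x) := by
  induction u with
  | nil => rfl
  | cons b u ih => funext k; cases k <;> simp [prepend, ih]

theorem place_append {ι : Type} (u v : ι → List Bool) (x : CantorPower ι) :
    place (fun i => u i ++ v i) x = place u (place v x) := by
  funext i; exact prepend_append _ _ _

namespace Pattern

variable {ι : Type}

/-- Subdivide each rectangle `p` of `P` by the pattern `R p`. -/
def graft : (P : Pattern ι) → (P.Piece → Pattern ι) → Pattern ι
  | unit, R => R ()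
  | cut d P Q, R => cut d (P.graft fun p => R (Sum.inl p)) (Q.graft fun q => R (Sum.inr q))

/-- The rectangles of a subdivided pattern. -/
def graftEquiv : (P : Pattern ι) → (R : P.Piece → Pattern ι) →
    ((Σ p, (R p).Piece) ≃ (P.graft R).Piece)
  | unit, _ =>
      { toFun := fun s => s.2
        invFun := fun r => ⟨(), r⟩
        left_inv := fun _ => rfl
        right_inv := fun _ => rfl }
  | cut _ P Q, R =>
      (Equiv.sumSigmaDistrib (α := P.Piece) (β := Q.Piece) fun p => (R p).Piece).trans
        (Equiv.sumCongr (P.graftEquiv fun p => R (Sum.inl p))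
          (Q.graftEquiv fun q => R (Sum.inr q)))

variable [DecidableEq ι]

theorem addr_graftEquiv (P : Pattern ι) (R : P.Piece → Pattern ι) (p : P.Piece)
    (r : (R p).Piece) :
    (P.graft R).addr (P.graftEquiv R ⟨p, r⟩) = fun i => P.addr p i ++ (R p).addr r i := by
  induction P with
  | unit => rfl
  | cut d P Q ihP ihQ =>
    rcases p with p | p
    · have h := ihP (fun p => R (Sum.inl p)) p r
      change Function.update ((P.graft fun p => R (Sum.inl p)).addr
        (P.graftEquiv (fun p => R (Sum.inl p)) ⟨p, r⟩)) d (false :: _) = _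
      rw [h]
      funext i
      by_cases hi : i = d
      · subst hi; simp [addr]
      · simp [addr, hi]
    · have h := ihQ (fun q => R (Sum.inr q)) p r
      change Function.update ((Q.graft fun q => R (Sum.inr q)).addr
        (Q.graftEquiv (fun q => R (Sum.inr q)) ⟨p, r⟩)) d (true :: _) = _
      rw [h]
      funext i
      by_cases hi : i = d
      · subst hi; simp [addr]
      · simp [addr, hi]

/-- `T` subdivides the rectangles of `P`. -/
def Refines (P T : Pattern ι) : Prop :=
  ∃ (R : P.Piece → Pattern ι) (e : (Σ p, (R p).Piece) ≃ T.Piece),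
    ∀ p r, T.addr (e ⟨p, r⟩) = fun i => P.addr p i ++ (R p).addr r i

theorem Refines.of_equiv {P T : Pattern ι} (e : P.Piece ≃ T.Piece)
    (h : ∀ p, T.addr (e p) = P.addr p) : Refines P T := by
  refine ⟨fun _ => unit,
    { toFun := fun s => e s.1
      invFun := fun t => ⟨e.symm t, ()⟩
      left_inv := fun s => by simp; rfl
      right_inv := fun t => by simp }, fun p r => ?_⟩
  funext i
  exact (congrFun (h p) i).trans (List.append_nil _).symm

theorem Refines.refl (P : Pattern ι) : Refines P P := .of_equiv (Equiv.refl _) fun _ => rfl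

theorem Refines.unit (T : Pattern ι) : Refines unit T :=
  ⟨fun _ => T,
    { toFun := fun s => s.2
      invFun := fun r => ⟨(), r⟩
      left_inv := fun _ => rfl
      right_inv := fun _ => rfl }, fun _ _ => rfl⟩

theorem Refines.trans {P S T : Pattern ι} (h : Refines P S) (h' : Refines S T) :
    Refines P T := by
  obtain ⟨R, e, he⟩ := h
  obtain ⟨R', e', he'⟩ := h'
  refine ⟨fun p => (R p).graft fun r => R' (e ⟨p, r⟩),
    ((Equiv.sigmaCongrRight fun p => ((R p).graftEquiv fun r => R' (e ⟨p, r⟩)).symm).trans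
      (Equiv.sigmaAssoc fun p r => (R' (e ⟨p, r⟩)).Piece).symm).trans
      ((Equiv.sigmaCongrLeft (β := fun s => (R' s).Piece) e).trans e'), fun p t => ?_⟩
  obtain ⟨⟨r, s⟩, rfl⟩ := ((R p).graftEquiv fun r => R' (e ⟨p, r⟩)).surjective t
  rw [addr_graftEquiv]
  have h1 := he' (e ⟨p, r⟩) s
  rw [he p r] at h1
  simp only [List.append_assoc] at h1
  rw [← h1]
  simp [Equiv.sigmaAssoc]

theorem Refines.cut {P P' Q Q' : Pattern ι} (d : ι) (hP : Refines P P') (hQ : Refines Q Q') :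
    Refines (cut d P Q) (cut d P' Q') := by
  obtain ⟨R, e, he⟩ := hP
  obtain ⟨R', e', he'⟩ := hQ
  refine ⟨Sum.elim R R',
    (Equiv.sumSigmaDistrib (α := P.Piece) (β := Q.Piece) fun s =>
      (Sum.elim R R' s).Piece).trans (Equiv.sumCongr e e'), fun p r => ?_⟩
  rcases p with p | p
  · change Function.update (P'.addr (e ⟨p, r⟩)) d (false :: _) = _
    rw [he p r]
    funext i
    by_cases hi : i = d
    · subst hi; simp [addr]; exact congrFun (he p r) i
    · simp only [addr, ne_eq, hi, not_false_eq_true, Function.update_of_ne]; rfl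
  · change Function.update (Q'.addr (e' ⟨p, r⟩)) d (true :: _) = _
    rw [he' p r]
    funext i
    by_cases hi : i = d
    · subst hi; simp [addr]; exact congrFun (he' p r) i
    · simp only [addr, ne_eq, hi, not_false_eq_true, Function.update_of_ne]; rfl

theorem exists_refines_cut (P : Pattern ι) (d : ι) : ∃ P₀ P₁, Refines P (.cut d P₀ P₁) := by
  induction P with
  | unit => exact ⟨.unit, .unit, Refines.unit _⟩
  | cut d' A B ihA ihB =>
    by_cases h : d' = d
    · subst h; exact ⟨A, B, Refines.refl _⟩
    · obtain ⟨A₀, A₁, hA⟩ := ihA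
      obtain ⟨B₀, B₁, hB⟩ := ihB
      refine ⟨.cut d' A₀ B₀, .cut d' A₁ B₁, (Refines.cut d' hA hB).trans ?_⟩
      have h' : d ≠ d' := fun h' => h h'.symm
      refine .of_equiv (P := .cut d' (.cut d A₀ A₁) (.cut d B₀ B₁))
        (T := .cut d (.cut d' A₀ B₀) (.cut d' A₁ B₁))
        { toFun := fun
            | .inl (.inl p) => .inl (.inl p)
            | .inl (.inr p) => .inr (.inl p)
            | .inr (.inl p) => .inl (.inr p)
            | .inr (.inr p) => .inr (.inr p)
          invFun := fun
            | .inl (.inl p) => .inl (.inl p)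
            | .inl (.inr p) => .inr (.inl p)
            | .inr (.inl p) => .inl (.inr p)
            | .inr (.inr p) => .inr (.inr p)
          left_inv := by rintro ((p | p) | (p | p)) <;> rfl
          right_inv := by rintro ((p | p) | (p | p)) <;> rfl } ?_
      rintro ((p | p) | (p | p)) <;>
      · simp only [addr, Equiv.coe_fn_mk, Function.update_of_ne h, Function.update_of_ne h']
        exact (Function.update_comm h' _ _ _).symm

theorem exists_common_refinement (P Q : Pattern ι) : ∃ T, Refines P T ∧ Refines Q T := by
  induction Q generalizing P with
  | unit => exact ⟨P, Refines.refl _, Refines.unit _⟩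
  | cut d A B ihA ihB =>
    obtain ⟨P₀, P₁, h⟩ := P.exists_refines_cut d
    obtain ⟨T₀, h₀, h₀'⟩ := ihA P₀
    obtain ⟨T₁, h₁, h₁'⟩ := ihB P₁
    exact ⟨.cut d T₀ T₁, h.trans (Refines.cut d h₀ h₁), Refines.cut d h₀' h₁'⟩

/-- If the range pattern of a pattern map is subdivided, the domain pattern can be subdivided
accordingly. -/
theorem Refines.pull {P Q T : Pattern ι} {f : CantorPower ι → CantorPower ι}
    (e : P.Piece ≃ Q.Piece) (hf : ∀ p x, f (place (P.addr p) x) = place (Q.addr (e p)) x)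
    (h : Refines Q T) :
    ∃ (S : Pattern ι) (e' : S.Piece ≃ T.Piece),
      ∀ s x, f (place (S.addr s) x) = place (T.addr (e' s)) x := by
  obtain ⟨R, ε, hε⟩ := h
  refine ⟨P.graft fun p => R (e p), (P.graftEquiv fun p => R (e p)).symm.trans
    ((Equiv.sigmaCongrLeft (β := fun q => (R q).Piece) e).trans ε), fun s x => ?_⟩
  obtain ⟨⟨p, r⟩, rfl⟩ := (P.graftEquiv fun p => R (e p)).surjective s
  have h1 := hε (e p) r
  rw [addr_graftEquiv, place_append, hf, ← place_append, ← h1]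
  simp

end Pattern

theorem IsPatternMap.id {ι : Type} [DecidableEq ι] :
    IsPatternMap (fun x : CantorPower ι => x) :=
  ⟨.unit, .unit, Equiv.refl _, fun _ _ => rfl⟩

theorem IsPatternMap.symm {ι : Type} [DecidableEq ι] {f : CantorPower ι ≃ₜ CantorPower ι}
    (hf : IsPatternMap f) : IsPatternMap f.symm := by
  obtain ⟨P, Q, e, h⟩ := hf
  refine ⟨Q, P, e.symm, fun q x => ?_⟩
  rw [Homeomorph.symm_apply_eq, h, Equiv.apply_symm_apply]

theorem IsPatternMap.comp {ι : Type} [DecidableEq ι] {f g : CantorPower ι ≃ₜ CantorPower ι}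
    (hg : IsPatternMap g) (hf : IsPatternMap f) : IsPatternMap (fun x => g (f x)) := by
  obtain ⟨P, Q, e, h⟩ := hf
  obtain ⟨Q', P', e', h'⟩ := hg.symm
  obtain ⟨T, hT, hT'⟩ := Q.exists_common_refinement P'
  obtain ⟨S, ε, hε⟩ := hT.pull e h
  obtain ⟨S', ε', hε'⟩ := hT'.pull e' h'
  refine ⟨S, S', ε.trans ε'.symm, fun s x => ?_⟩
  have h2 := hε' (ε'.symm (ε s)) x
  rw [Equiv.apply_symm_apply, Homeomorph.symm_apply_eq] at h2
  change g (f _) = _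
  rw [hε, ← h2]
  rfl

/-- The group of all self-homeomorphisms of `𝔠^ι` given by pairs of numbered patterns. -/
def patternGroup (ι : Type) [DecidableEq ι] : Subgroup (CantorPower ι ≃ₜ CantorPower ι) where
  carrier := {f | IsPatternMap f}
  one_mem' := IsPatternMap.id
  mul_mem' hg hf := hg.comp hf
  inv_mem' hf := hf.symm

/-- The higher dimensional Thompson group `nV`. -/
def nV (n : ℕ) : Subgroup (CantorPower (Fin n) ≃ₜ CantorPower (Fin n)) := patternGroup (Fin n)

/-! The ascending union of the groups `nV`. -/

theorem continuous_extend {ι κ : Type} (φ : ι ↪ κ) (f : CantorPower ι → CantorPower ι)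
    (hf : Continuous f) :
    Continuous fun x : CantorPower κ => (Function.extend φ (f fun i => x (φ i)) x) := by
  refine continuous_pi fun k => ?_
  by_cases hk : ∃ i, φ i = k
  · obtain ⟨i, rfl⟩ := hk
    simp only [φ.injective.extend_apply]
    fun_prop
  · simp only [Function.extend_apply' _ _ _ hk]
    fun_prop

theorem extend_comp {ι κ : Type} (φ : ι ↪ κ) (f g : CantorPower ι → CantorPower ι)
    (x : CantorPower κ) :
    Function.extend φ (g fun i => Function.extend φ (f fun j => x (φ j)) x (φ i))
      (Function.extend φ (f fun j => x (φ j)) x) =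
    Function.extend φ (g (f fun j => x (φ j))) x := by
  funext k
  by_cases hk : ∃ i, φ i = k
  · obtain ⟨i, rfl⟩ := hk
    simp only [φ.injective.extend_apply]
  · simp only [Function.extend_apply' _ _ _ hk]

theorem extend_self {ι κ : Type} (φ : ι ↪ κ) (x : CantorPower κ) :
    Function.extend φ (fun i => x (φ i)) x = x := by
  funext k
  by_cases hk : ∃ i, φ i = k
  · obtain ⟨i, rfl⟩ := hk
    simp only [φ.injective.extend_apply]
  · simp only [Function.extend_apply' _ _ _ hk]

/-- Let a homeomorphism of `𝔠^ι` act on `𝔠^κ`, where `ι ⊆ κ`: it acts on the coordinates in `ι`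
and leaves the other coordinates unchanged. -/
noncomputable def extendHomeo {ι κ : Type} (φ : ι ↪ κ) (f : CantorPower ι ≃ₜ CantorPower ι) :
    CantorPower κ ≃ₜ CantorPower κ where
  toFun x := Function.extend φ (f fun i => x (φ i)) x
  invFun x := Function.extend φ (f.symm fun i => x (φ i)) x
  left_inv x := by
    refine (extend_comp φ f f.symm x).trans ?_
    rw [f.symm_apply_apply, extend_self]
  right_inv x := by
    refine (extend_comp φ f.symm f x).trans ?_
    rw [f.apply_symm_apply, extend_self]
  continuous_toFun := continuous_extend φ f f.continuous
  continuous_invFun := continuous_extend φ f.symm f.symm.continuous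

theorem extendHomeo_apply {ι κ : Type} (φ : ι ↪ κ) (f : CantorPower ι ≃ₜ CantorPower ι)
    (x : CantorPower κ) (i : ι) : extendHomeo φ f x (φ i) = f (fun j => x (φ j)) i :=
  φ.injective.extend_apply _ _ _

theorem extendHomeo_apply' {ι κ : Type} (φ : ι ↪ κ) (f : CantorPower ι ≃ₜ CantorPower ι)
    (x : CantorPower κ) (k : κ) (hk : ¬ ∃ i, φ i = k) : extendHomeo φ f x k = x k :=
  Function.extend_apply' _ _ _ hk

theorem extendHomeo_one {ι κ : Type} (φ : ι ↪ κ) :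
    extendHomeo φ (1 : CantorPower ι ≃ₜ CantorPower ι) = 1 :=
  Homeomorph.ext fun x => extend_self φ x

theorem extendHomeo_mul {ι κ : Type} (φ : ι ↪ κ) (g f : CantorPower ι ≃ₜ CantorPower ι) :
    extendHomeo φ (g * f) = extendHomeo φ g * extendHomeo φ f :=
  Homeomorph.ext fun x => (extend_comp φ f g x).symm

theorem extendHomeo_trans {ι κ μ : Type} (φ : ι ↪ κ) (ψ : κ ↪ μ)
    (f : CantorPower ι ≃ₜ CantorPower ι) :
    extendHomeo ψ (extendHomeo φ f) = extendHomeo (φ.trans ψ) f := by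
  ext x k : 2
  by_cases hk : ∃ j, ψ j = k
  · obtain ⟨j, rfl⟩ := hk
    rw [extendHomeo_apply]
    by_cases hj : ∃ i, φ i = j
    · obtain ⟨i, rfl⟩ := hj
      rw [extendHomeo_apply]
      exact (extendHomeo_apply (φ.trans ψ) f x i).symm
    · rw [extendHomeo_apply' _ _ _ _ hj, extendHomeo_apply']
      rintro ⟨i, hi⟩
      exact hj ⟨i, ψ.injective hi⟩
  · rw [extendHomeo_apply' _ _ _ _ hk, extendHomeo_apply']
    rintro ⟨i, hi⟩
    exact hk ⟨φ i, hi⟩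

namespace Pattern

/-- Regard a pattern in the dimensions `ι ⊆ κ` as a pattern in the dimensions `κ`. -/
def map {ι κ : Type} (φ : ι ↪ κ) : Pattern ι → Pattern κ
  | unit => unit
  | cut d P Q => cut (φ d) (P.map φ) (Q.map φ)

/-- The rectangles of a pattern regarded in more dimensions. -/
def mapEquiv {ι κ : Type} (φ : ι ↪ κ) : (P : Pattern ι) → P.Piece ≃ (P.map φ).Piece
  | unit => Equiv.refl Unit
  | cut _ P Q => Equiv.sumCongr (P.mapEquiv φ) (Q.mapEquiv φ)

theorem addr_mapEquiv {ι κ : Type} [DecidableEq ι] [DecidableEq κ] (φ : ι ↪ κ) (P : Pattern ι)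
    (p : P.Piece) :
    (P.map φ).addr (P.mapEquiv φ p) = Function.extend φ (P.addr p) fun _ => [] := by
  induction P with
  | unit =>
    funext k
    by_cases hk : ∃ i, φ i = k
    · obtain ⟨i, rfl⟩ := hk
      rw [φ.injective.extend_apply]; rfl
    · rw [Function.extend_apply' _ _ _ hk]; rfl
  | cut d P Q ihP ihQ =>
    rcases p with p | p
    · change Function.update ((P.map φ).addr (P.mapEquiv φ p)) (φ d) (false :: _) = _
      rw [ihP p]
      funext k
      by_cases hk : ∃ i, φ i = k
      · obtain ⟨i, rfl⟩ := hk
        by_cases hi : i = d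
        · subst hi; simp [addr, φ.injective.extend_apply]
        · simp [addr, φ.injective.extend_apply, hi]
      · have hk' : k ≠ φ d := fun h => hk ⟨d, h.symm⟩
        simp [hk', Function.extend_apply' _ _ _ hk]
    · change Function.update ((Q.map φ).addr (Q.mapEquiv φ p)) (φ d) (true :: _) = _
      rw [ihQ p]
      funext k
      by_cases hk : ∃ i, φ i = k
      · obtain ⟨i, rfl⟩ := hk
        by_cases hi : i = d
        · subst hi; simp [addr, φ.injective.extend_apply]
        · simp [addr, φ.injective.extend_apply, hi]
      · have hk' : k ≠ φ d := fun h => hk ⟨d, h.symm⟩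
        simp [hk', Function.extend_apply' _ _ _ hk]

end Pattern

theorem extendHomeo_mem {ι κ : Type} [DecidableEq ι] [DecidableEq κ] (φ : ι ↪ κ)
    {f : CantorPower ι ≃ₜ CantorPower ι} (hf : f ∈ patternGroup ι) :
    extendHomeo φ f ∈ patternGroup κ := by
  obtain ⟨P, Q, e, h⟩ := hf
  refine ⟨P.map φ, Q.map φ, (P.mapEquiv φ).symm.trans (e.trans (Q.mapEquiv φ)), fun p x => ?_⟩
  obtain ⟨p, rfl⟩ := (P.mapEquiv φ).surjective p
  simp only [Equiv.trans_apply, Equiv.symm_apply_apply, Pattern.addr_mapEquiv]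
  funext k
  by_cases hk : ∃ i, φ i = k
  · obtain ⟨i, rfl⟩ := hk
    rw [extendHomeo_apply]
    have h1 := congrFun (h p fun j => x (φ j)) i
    simp only [place, φ.injective.extend_apply]
    exact h1
  · rw [extendHomeo_apply' _ _ _ _ hk]
    simp [place, prepend, Function.extend_apply' _ _ _ hk]

/-- A homeomorphism of `𝔠^n`, acting on the first `n` coordinates of `𝔠^ω`. -/
noncomputable def stabilize (n : ℕ) (f : CantorPower (Fin n) ≃ₜ CantorPower (Fin n)) :
    CantorPower ℕ ≃ₜ CantorPower ℕ :=
  extendHomeo Fin.valEmbedding f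

theorem stabilize_ascending {n m : ℕ} (h : n ≤ m)
    {f : CantorPower (Fin n) ≃ₜ CantorPower (Fin n)} (hf : f ∈ nV n) :
    ∃ g ∈ nV m, stabilize m g = stabilize n f :=
  ⟨extendHomeo (Fin.castLEEmb h) f, extendHomeo_mem _ hf, extendHomeo_trans _ _ _⟩

/-- The group `ωV`: the union of the groups `1V ⊆ 2V ⊆ 3V ⊆ ⋯`, each of them acting on the first
coordinates of `𝔠^ω`. -/
def omegaV : Subgroup (CantorPower ℕ ≃ₜ CantorPower ℕ) where
  carrier := {g | ∃ n : ℕ, ∃ f ∈ nV n, stabilize n f = g}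
  one_mem' := ⟨0, 1, one_mem _, extendHomeo_one _⟩
  mul_mem' := by
    rintro _ _ ⟨n, f, hf, rfl⟩ ⟨m, g, hg, rfl⟩
    obtain ⟨f', hf', h⟩ := stabilize_ascending (le_max_left n m) hf
    obtain ⟨g', hg', h'⟩ := stabilize_ascending (le_max_right n m) hg
    exact ⟨max n m, f' * g', mul_mem hf' hg', by rw [← h, ← h']; exact extendHomeo_mul _ _ _⟩
  inv_mem' := by
    rintro _ ⟨n, f, hf, rfl⟩
    refine ⟨n, f⁻¹, inv_mem hf, eq_inv_of_mul_eq_one_left ?_⟩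
    rw [stabilize, stabilize, ← extendHomeo_mul, inv_mul_cancel, extendHomeo_one]

end HigherThompson

namespace HigherThompson

/-! ### Geometry of dyadic rectangles -/

section Geometry

variable {ι : Type} [DecidableEq ι]

/-! Two dissections D, E with the same labels determine one group element, carrying each rectangle
of D canonically to the rectangle of E with the same label, and every element of the group arises
so. Its class `cl D E` in the abelianization satisfies `cl D E * cl E F = cl D F` and is unchanged
when D and E are relabelled, or cut at the same label and direction, simultaneously. It suffices to
show that it is always trivial.

A transposition of two rectangles becomes, once both are halved, a product of two conjugate
transpositions, so its class is a square of the class of an involution and vanishes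
(`cl_reindex_swap`). Hence labels are irrelevant, and a cut may be moved to another rectangle
(`cl_cutAt_cutAt`).

Let t_n be the class of turning one cut from direction d to d' in a dissection with n rectangles
before the cut. It depends only on n, d, d', and t_n = t_{n+1} for n ≥ 2 (`cl_turn_succ`).
Quartering a rectangle by d then d', or by d' then d, gives the same four pieces, whence t_n =
t_{n+1}² (`cl_turn_eq_mul`). So t_n = 1 for n ≥ 2, and then t_1 = 1. Induction on the number of
rectangles, removing a last cut on both sides, finishes the proof (`cl_eq_one`). -/

theorem continuous_prepend (w : List Bool) : Continuous (prepend w) := by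
  induction w with
  | nil => exact continuous_id
  | cons b w ih =>
    refine continuous_pi fun k => ?_
    cases k with
    | zero => exact continuous_const
    | succ k => exact (continuous_apply k).comp ih

theorem continuous_place {ι : Type} (w : ι → List Bool) : Continuous (place w) :=
  continuous_pi fun i => (continuous_prepend (w i)).comp (continuous_apply i)

/-- The canonical map from the cube onto one of its halves across dimension `d`. -/
def half (d : ι) (b : Bool) (x : CantorPower ι) : CantorPower ι :=
  Function.update x d (prepend [b] (x d))

theorem half_apply_zero (d : ι) (b : Bool) (x : CantorPower ι) : half d b x d 0 = b := by
  simp [half, prepend]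

theorem half_injective (d : ι) (b : Bool) : Function.Injective (half d b) := by
  intro x y h
  funext i
  by_cases hi : i = d
  · subst hi
    funext k
    have := congrFun (congrFun h i) (k + 1)
    simpa [half, prepend] using this
  · simpa [half, hi] using congrFun h i

theorem exists_half_eq (d : ι) (x : CantorPower ι) : ∃ y, half d (x d 0) y = x := by
  refine ⟨Function.update x d fun k => x d (k + 1), ?_⟩
  funext i
  by_cases hi : i = d
  · subst hi
    funext k
    cases k <;> simp [half, prepend]
  · simp [half, hi]

theorem place_update_cons (d : ι) (b : Bool) (w : ι → List Bool) (x : CantorPower ι) :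
    place (Function.update w d (b :: w d)) x = half d b (place w x) := by
  funext i
  by_cases hi : i = d
  · subst hi; simp [place, half, prepend]
  · simp [place, half, hi]

/-- The words of one half of the rectangle described by `w`. -/
def extendWord (d : ι) (b : Bool) (w : ι → List Bool) : ι → List Bool :=
  Function.update w d (w d ++ [b])

theorem place_extendWord (d : ι) (b : Bool) (w : ι → List Bool) (x : CantorPower ι) :
    place (extendWord d b w) x = place w (half d b x) := by
  funext i
  by_cases hi : i = d
  · subst hi; simp [place, half, extendWord, prepend_append]
  · simp [place, half, extendWord, hi]

theorem extendWord_comm {d d' : ι} (h : d ≠ d') (b b' : Bool) (w : ι → List Bool) :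
    extendWord d b (extendWord d' b' w) = extendWord d' b' (extendWord d b w) := by
  simp only [extendWord, Function.update_of_ne h, Function.update_of_ne h.symm]
  exact Function.update_comm h.symm _ _ _

/-- Placing a pattern in a half of the cube adds a letter in front of a word, halving a rectangle
adds one at the end. The two operations commute even in the same dimension, so a cut of a rectangle
survives passage to a larger pattern. -/
theorem extendWord_update_cons (d d' : ι) (b b' : Bool) (w : ι → List Bool) :
    Function.update (extendWord d b w) d' (b' :: extendWord d b w d') =
      extendWord d b (Function.update w d' (b' :: w d')) := by
  funext i
  by_cases hi : i = d <;> by_cases hi' : i = d' <;> subst_vars <;> simp_all [extendWord]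

end Geometry

/-! ### Cutting one rectangle of a pattern -/

section Cut

variable {ι : Type} [DecidableEq ι]

open Classical in
/-- The family of rectangles obtained by halving the member `k` of the family `a`. -/
noncomputable def cutWords {κ : Type} (a : κ → ι → List Bool) (k : κ) (d : ι) :
    Option κ → ι → List Bool
  | none => extendWord d true (a k)
  | some j => if j = k then extendWord d false (a k) else a j

namespace Pattern

instance finite_piece {ι : Type} (P : Pattern ι) : Finite P.Piece := by
  induction P with
  | unit => exact inferInstanceAs (Finite Unit)
  | cut d P Q ihP ihQ => exact inferInstanceAs (Finite (P.Piece ⊕ Q.Piece))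

/-- The first digit of the coordinate `d` decides in which half of the cube a point lies. -/
theorem bijective_place (P : Pattern ι) :
    Function.Bijective fun s : P.Piece × CantorPower ι => place (P.addr s.1) s.2 := by
  induction P with
  | unit => exact ⟨fun s t h => Prod.ext rfl h, fun x => ⟨((), x), rfl⟩⟩
  | cut d P Q ihP ihQ =>
    constructor
    · rintro ⟨p | p, x⟩ ⟨q | q, y⟩ h
      · simp only [addr, place_update_cons] at h
        have := @ihP.1 (p, x) (q, y) (half_injective _ _ h)
        simp only [Prod.mk.injEq] at this
        rw [this.1, this.2]
      · simp only [addr, place_update_cons] at h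
        have := congrFun (congrFun h d) 0
        simp [half_apply_zero] at this
      · simp only [addr, place_update_cons] at h
        have := congrFun (congrFun h d) 0
        simp [half_apply_zero] at this
      · simp only [addr, place_update_cons] at h
        have := @ihQ.1 (p, x) (q, y) (half_injective _ _ h)
        simp only [Prod.mk.injEq] at this
        rw [this.1, this.2]
    · intro x
      obtain ⟨y, hy⟩ := exists_half_eq d x
      cases hb : x d 0 with
      | false =>
        obtain ⟨⟨p, z⟩, hz⟩ := ihP.2 y
        refine ⟨(Sum.inl p, z), ?_⟩
        simp only at hz
        simp only [addr, place_update_cons]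
        rw [hz, ← hb, hy]
      | true =>
        obtain ⟨⟨p, z⟩, hz⟩ := ihQ.2 y
        refine ⟨(Sum.inr p, z), ?_⟩
        simp only at hz
        simp only [addr, place_update_cons]
        rw [hz, ← hb, hy]

/-- `P'` arises from `P` by halving the rectangle `p` across dimension `d`. -/
def IsCutOf (P' P : Pattern ι) (p : P.Piece) (d : ι) : Prop :=
  ∃ e : Option P.Piece ≃ P'.Piece, ∀ o, P'.addr (e o) = cutWords P.addr p d o

theorem isCutOf_unit (p : (unit : Pattern ι).Piece) (d : ι) :
    IsCutOf (cut d unit unit) unit p d := by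
  refine ⟨(Equiv.optionEquivSumPUnit Unit).trans (Equiv.refl _), ?_⟩
  rintro (_ | q)
  · rfl
  · exact (if_pos rfl).symm

theorem IsCutOf.inl {P P' : Pattern ι} {p : P.Piece} {d : ι} (h : IsCutOf P' P p d) (d' : ι)
    (Q : Pattern ι) : IsCutOf (cut d' P' Q) (cut d' P Q) (Sum.inl p) d := by
  obtain ⟨e, he⟩ := h
  refine ⟨
    { toFun := fun
        | none => .inl (e none)
        | some (.inl q) => .inl (e (some q))
        | some (.inr q) => .inr q
      invFun := fun
        | .inl q => (e.symm q).map Sum.inl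
        | .inr q => some (.inr q)
      left_inv := by rintro (_ | _ | _) <;> simp <;> rfl
      right_inv := by
        rintro (q | q)
        · obtain ⟨_ | o, rfl⟩ := e.surjective q <;> simp <;> rfl
        · rfl }, ?_⟩
  rintro (_ | q | q)
  · change Function.update (P'.addr (e none)) d' (false :: P'.addr (e none) d') = _
    rw [he]
    exact extendWord_update_cons _ _ _ _ _
  · change Function.update (P'.addr (e (some q))) d' (false :: P'.addr (e (some q)) d') = _
    rw [he]
    by_cases hq : q = p
    · subst hq
      simp only [cutWords, if_true]
      exact (extendWord_update_cons _ _ _ _ _).trans (if_pos rfl).symm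
    · have hq' : (Sum.inl q : (cut d' P Q).Piece) ≠ Sum.inl p := fun h => hq (Sum.inl.inj h)
      simp only [cutWords, if_neg hq]
      exact (if_neg hq').symm
  · exact (if_neg (by exact Sum.inr_ne_inl)).symm

theorem IsCutOf.inr {P P' : Pattern ι} {p : P.Piece} {d : ι} (h : IsCutOf P' P p d) (d' : ι)
    (Q : Pattern ι) : IsCutOf (cut d' Q P') (cut d' Q P) (Sum.inr p) d := by
  obtain ⟨e, he⟩ := h
  refine ⟨
    { toFun := fun
        | none => .inr (e none)
        | some (.inr q) => .inr (e (some q))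
        | some (.inl q) => .inl q
      invFun := fun
        | .inr q => (e.symm q).map Sum.inr
        | .inl q => some (.inl q)
      left_inv := by rintro (_ | _ | _) <;> simp <;> rfl
      right_inv := by
        rintro (q | q)
        · rfl
        · obtain ⟨_ | o, rfl⟩ := e.surjective q <;> simp <;> rfl }, ?_⟩
  rintro (_ | q | q)
  · change Function.update (P'.addr (e none)) d' (true :: P'.addr (e none) d') = _
    rw [he]
    exact extendWord_update_cons _ _ _ _ _
  · exact (if_neg (by exact Sum.inl_ne_inr)).symm
  · change Function.update (P'.addr (e (some q))) d' (true :: P'.addr (e (some q)) d') = _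
    rw [he]
    by_cases hq : q = p
    · subst hq
      simp only [cutWords, if_true]
      exact (extendWord_update_cons _ _ _ _ _).trans (if_pos rfl).symm
    · have hq' : (Sum.inr q : (cut d' Q P).Piece) ≠ Sum.inr p := fun h => hq (Sum.inr.inj h)
      simp only [cutWords, if_neg hq]
      exact (if_neg hq').symm

theorem exists_isCutOf (P : Pattern ι) (p : P.Piece) (d : ι) : ∃ P', IsCutOf P' P p d := by
  induction P with
  | unit => exact ⟨_, isCutOf_unit p d⟩
  | cut d' P Q ihP ihQ =>
    rcases p with p | p
    · obtain ⟨P', h⟩ := ihP p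
      exact ⟨_, h.inl d' Q⟩
    · obtain ⟨Q', h⟩ := ihQ p
      exact ⟨_, h.inr d' P⟩

/-- A nontrivial finite binary tree has a vertex both of whose children are leaves; the cut there
can be undone. -/
theorem eq_unit_or_isCutOf (P : Pattern ι) :
    P = unit ∨ ∃ (P' : Pattern ι) (p : P'.Piece) (d : ι), IsCutOf P P' p d := by
  induction P with
  | unit => exact Or.inl rfl
  | cut d P Q ihP ihQ =>
    right
    rcases ihP with rfl | ⟨P', p, d', h⟩
    · rcases ihQ with rfl | ⟨Q', q, d', h⟩
      · exact ⟨unit, (), d, isCutOf_unit _ _⟩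
      · exact ⟨_, _, _, h.inr d unit⟩
    · exact ⟨_, _, _, h.inl d Q⟩

end Pattern

end Cut

/-! ### Dissections -/

/-- The rectangles of a pattern, labelled by a type `κ`. -/
@[ext]
structure Dissection (ι κ : Type) [DecidableEq ι] where
  word : κ → ι → List Bool
  exists_pattern : ∃ (P : Pattern ι) (e : κ ≃ P.Piece), ∀ k, word k = P.addr (e k)

namespace Dissection

variable {ι κ μ : Type} [DecidableEq ι]

/-- Change the labels of a dissection. -/
def reindex (D : Dissection ι κ) (σ : μ ≃ κ) : Dissection ι μ where
  word m := D.word (σ m)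
  exists_pattern := by
    obtain ⟨P, e, h⟩ := D.exists_pattern
    exact ⟨P, σ.trans e, fun m => h (σ m)⟩

/-- The dissection into the rectangles of a pattern. -/
def ofPattern (P : Pattern ι) : Dissection ι P.Piece := ⟨P.addr, P, Equiv.refl _, fun _ => rfl⟩

/-- Halve the rectangle `k` across dimension `d`; the lower half keeps the label. -/
noncomputable def cutAt (D : Dissection ι κ) (k : κ) (d : ι) : Dissection ι (Option κ) where
  word := cutWords D.word k d
  exists_pattern := by
    obtain ⟨P, e, h⟩ := D.exists_pattern
    obtain ⟨P', e', h'⟩ := P.exists_isCutOf (e k) d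
    refine ⟨P', e.optionCongr.trans e', fun o => ?_⟩
    rw [Equiv.trans_apply, h']
    rcases o with _ | j
    · simp [cutWords, h]
    · by_cases hj : j = k
      · subst hj; simp [cutWords, h]
      · simp [cutWords, h, hj]

theorem finite (D : Dissection ι κ) : Finite κ := by
  obtain ⟨P, e, -⟩ := D.exists_pattern
  exact Finite.of_equiv _ e.symm

theorem exists_eq_reindex (D : Dissection ι κ) :
    ∃ (P : Pattern ι) (e : κ ≃ P.Piece), D = (ofPattern P).reindex e := by
  obtain ⟨P, e, h⟩ := D.exists_pattern
  exact ⟨P, e, Dissection.ext (funext h)⟩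

theorem bijective_place (D : Dissection ι κ) :
    Function.Bijective fun s : κ × CantorPower ι => place (D.word s.1) s.2 := by
  obtain ⟨P, e, rfl⟩ := D.exists_eq_reindex
  exact P.bijective_place.comp (e.prodCongr (Equiv.refl (CantorPower ι))).bijective

/-- Every dissection either consists of the cube only or comes from a cut. -/
theorem eq_unit_or_cutAt (D : Dissection ι κ) :
    (Subsingleton κ ∧ D.word = fun _ _ => []) ∨
      ∃ (μ : Type) (e : κ ≃ Option μ) (D' : Dissection ι μ) (m : μ) (d : ι),
        D = (D'.cutAt m d).reindex e := by
  obtain ⟨P, e, h⟩ := D.exists_pattern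
  rcases P.eq_unit_or_isCutOf with rfl | ⟨P', p, d, e', h'⟩
  · exact Or.inl ⟨@Equiv.subsingleton _ _ e (inferInstanceAs (Subsingleton Unit)), funext h⟩
  · refine Or.inr ⟨P'.Piece, e.trans e'.symm, ofPattern P', p, d,
      Dissection.ext (funext fun k => ?_)⟩
    rw [h]
    exact (congrArg P.addr (e'.apply_symm_apply (e k)).symm).trans (h' _)

/-! ### Group elements carrying one dissection to another -/

/-- `f` maps each rectangle of `D` canonically onto the one of `E` with the same label. -/
def Carries (f : CantorPower ι ≃ₜ CantorPower ι) (D E : Dissection ι κ) : Prop :=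
  ∀ k x, f (place (D.word k) x) = place (E.word k) x

theorem Carries.unique {f g : CantorPower ι ≃ₜ CantorPower ι} {D E : Dissection ι κ}
    (hf : Carries f D E) (hg : Carries g D E) : f = g := by
  refine Homeomorph.ext fun x => ?_
  obtain ⟨⟨k, y⟩, rfl⟩ := D.bijective_place.2 x
  exact (hf k y).trans (hg k y).symm

theorem Carries.mem {f : CantorPower ι ≃ₜ CantorPower ι} {D E : Dissection ι κ}
    (hf : Carries f D E) : f ∈ patternGroup ι := by
  obtain ⟨P, e, h⟩ := D.exists_pattern
  obtain ⟨Q, e', h'⟩ := E.exists_pattern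
  refine ⟨P, Q, e.symm.trans e', fun p x => ?_⟩
  have := hf (e.symm p) x
  rw [h, h', Equiv.apply_symm_apply] at this
  exact this

theorem Carries.mul {f g : CantorPower ι ≃ₜ CantorPower ι} {D E F : Dissection ι κ}
    (hf : Carries f E F) (hg : Carries g D E) : Carries (f * g) D F := fun k x =>
  (congrArg f (hg k x)).trans (hf k x)

theorem Carries.reindex {f : CantorPower ι ≃ₜ CantorPower ι} {D E : Dissection ι κ}
    (hf : Carries f D E) (σ : μ ≃ κ) : Carries f (D.reindex σ) (E.reindex σ) :=
  fun m x => hf (σ m) x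

/-- Prefix replacement carries halves canonically to the corresponding halves. -/
theorem Carries.cutAt {f : CantorPower ι ≃ₜ CantorPower ι} {D E : Dissection ι κ}
    (hf : Carries f D E) (k : κ) (d : ι) : Carries f (D.cutAt k d) (E.cutAt k d) := by
  rintro (_ | j) x
  · simp only [Dissection.cutAt, cutWords, place_extendWord]
    exact hf _ _
  · by_cases hj : j = k
    · simp only [Dissection.cutAt, cutWords, hj, if_true, place_extendWord]
      exact hf _ _
    · simp only [Dissection.cutAt, cutWords, hj, if_false]
      exact hf _ _

theorem exists_carries (D E : Dissection ι κ) : ∃ f, Carries f D E := by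
  have := D.finite
  -- With the discrete topology on the finite label set, `κ × CantorPower ι` is compact, so the
  -- continuous bijection onto the cube given by a dissection is a homeomorphism.
  let _ : TopologicalSpace κ := ⊥
  have : DiscreteTopology κ := ⟨rfl⟩
  have key : ∀ F : Dissection ι κ, ∃ Φ : κ × CantorPower ι ≃ₜ CantorPower ι,
      ∀ s, Φ s = place (F.word s.1) s.2 := fun F =>
    ⟨Continuous.homeoOfEquivCompactToT2 (f := Equiv.ofBijective _ F.bijective_place)
      (continuous_prod_of_discrete_left.2 fun k => continuous_place (F.word k)), fun _ => rfl⟩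
  obtain ⟨Φ, hΦ⟩ := key D
  obtain ⟨Ψ, hΨ⟩ := key E
  refine ⟨Φ.symm.trans Ψ, fun k x => ?_⟩
  rw [← hΦ (k, x), ← hΨ (k, x)]
  simp

/-- The element of the pattern group that carries `D` to `E`. -/
noncomputable def carry (D E : Dissection ι κ) : patternGroup ι :=
  ⟨(exists_carries D E).choose, (exists_carries D E).choose_spec.mem⟩

theorem carries_carry (D E : Dissection ι κ) : Carries (carry D E) D E :=
  (exists_carries D E).choose_spec

theorem Carries.eq_carry {f : patternGroup ι} {D E : Dissection ι κ}
    (hf : Carries f D E) : f = carry D E :=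
  Subtype.ext (hf.unique (carries_carry D E))

theorem carry_self (D : Dissection ι κ) : carry D D = 1 :=
  (Carries.eq_carry (f := 1) fun _ _ => rfl).symm

theorem carry_mul_carry (D E F : Dissection ι κ) : carry E F * carry D E = carry D F :=
  ((carries_carry E F).mul (carries_carry D E)).eq_carry (f := carry E F * carry D E)

theorem carry_reindex (D E : Dissection ι κ) (σ : μ ≃ κ) :
    carry (D.reindex σ) (E.reindex σ) = carry D E :=
  ((carries_carry D E).reindex σ).eq_carry.symm

theorem carry_cutAt (D E : Dissection ι κ) (k : κ) (d : ι) :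
    carry (D.cutAt k d) (E.cutAt k d) = carry D E :=
  ((carries_carry D E).cutAt k d).eq_carry.symm

theorem reindex_reindex {ν : Type} (D : Dissection ι κ) (σ : μ ≃ κ) (τ : ν ≃ μ) :
    (D.reindex σ).reindex τ = D.reindex (τ.trans σ) := rfl

/-- The permutations of the rectangles of a dissection. -/
noncomputable def permHom (D : Dissection ι κ) : Equiv.Perm κ →* patternGroup ι where
  toFun σ := carry D (D.reindex σ)
  map_one' := carry_self D
  map_mul' σ τ := by
    -- The element for `σ` also carries `D.reindex τ` to `D.reindex (σ * τ)`.
    rw [← carry_reindex D (D.reindex σ) τ, ← carry_mul_carry D (D.reindex τ)]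
    rfl

/-! ### The class of a pair of dissections in the abelianization -/

/-- The class in the abelianization of the element that carries `D` to `E`. -/
noncomputable def cl (D E : Dissection ι κ) : Abelianization (patternGroup ι) :=
  Abelianization.of (carry D E)

theorem cl_self (D : Dissection ι κ) : cl D D = 1 := by rw [cl, carry_self, map_one]

theorem cl_mul_cl (D E F : Dissection ι κ) : cl D E * cl E F = cl D F := by
  rw [cl, cl, cl, mul_comm, ← map_mul, carry_mul_carry]

theorem cl_reindex (D E : Dissection ι κ) (σ : μ ≃ κ) :
    cl (D.reindex σ) (E.reindex σ) = cl D E := by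
  rw [cl, carry_reindex, cl]

theorem cl_cutAt (D E : Dissection ι κ) (k : κ) (d : ι) :
    cl (D.cutAt k d) (E.cutAt k d) = cl D E := by
  rw [cl, carry_cutAt, cl]

/-! ### Permutations of rectangles have trivial class -/

open Classical in
-- After halving both rectangles, the transposition is the product of the swap of the lower halves
-- and the swap of the upper halves. These are conjugate, so its class is the square of the class of
-- one swap, hence trivial. The direction `d` is arbitrary; it only serves for halving.
theorem cl_reindex_swap (D : Dissection ι κ) (d : ι) {i j : κ} (hij : i ≠ j) :
    cl D (D.reindex (Equiv.swap i j)) = 1 := by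
  set E := (D.cutAt i d).cutAt (some j) d with hE
  -- `s` swaps the lower halves, which keep their labels; `some none` and `none` label the upper
  -- halves of `i` and `j`.
  set s : Equiv.Perm (Option (Option κ)) := Equiv.swap (some (some i)) (some (some j))
  set t : Equiv.Perm (Option (Option κ)) := Equiv.swap (some none) none
  have h : Carries (carry D (D.reindex (Equiv.swap i j))) E (E.reindex (s * t)) := by
    have h0 := carries_carry D (D.reindex (Equiv.swap i j))
    have h1 := (h0.cutAt i d).cutAt (some j) d
    convert h1 using 1
    refine Dissection.ext (funext fun o => ?_)
    rcases o with _ | _ | k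
    · simp [hE, s, t, reindex, cutAt, cutWords, hij.symm, Equiv.swap_apply_def]
    · simp [hE, s, t, reindex, cutAt, cutWords, hij.symm, Equiv.swap_apply_def]
    · by_cases h1 : k = i
      · subst h1
        simp [hE, s, t, reindex, cutAt, cutWords, hij, hij.symm, Equiv.swap_apply_def]
      · by_cases h2 : k = j
        · subst h2
          simp [hE, s, t, reindex, cutAt, cutWords, hij, hij.symm, Equiv.swap_apply_def]
        · simp [hE, s, t, reindex, cutAt, cutWords, hij.symm, h1, h2, Equiv.swap_apply_def]
  have h2 : carry D (D.reindex (Equiv.swap i j)) = E.permHom (s * t) := h.eq_carry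
  have hst : IsConj s t := Equiv.Perm.isConj_swap (by simpa using hij) (by simp)
  have h3 := ((Abelianization.of (G := patternGroup ι)).comp E.permHom).map_isConj hst
  rw [isConj_iff_eq] at h3
  have h4 : cl D (D.reindex (Equiv.swap i j)) =
      (Abelianization.of.comp E.permHom) (s * t) := by rw [cl, h2]; rfl
  rw [h4, map_mul, ← h3, ← map_mul, Equiv.swap_mul_self, map_one]

theorem cl_reindex_self (D : Dissection ι κ) (d : ι) (σ : Equiv.Perm κ) :
    cl D (D.reindex σ) = 1 := by
  classical
  have := D.finite
  induction σ using Equiv.Perm.swap_induction_on with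
  | one => exact cl_self D
  | swap_mul f x y hxy ih =>
    rw [← cl_mul_cl D (D.reindex f), ih, one_mul]
    exact (cl_reindex D (D.reindex (Equiv.swap x y)) f).trans (cl_reindex_swap D d hxy)

theorem cl_eq_one_of_eq_reindex {D E : Dissection ι κ} (d : ι) (σ : Equiv.Perm κ)
    (h : E = D.reindex σ) : cl D E = 1 := h ▸ cl_reindex_self D d σ

/-! ### Moving and turning a cut -/

theorem cl_cutAt_cutAt (D : Dissection ι κ) (k j : κ) (d : ι) :
    cl (D.cutAt k d) (D.cutAt j d) = 1 := by
  classical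
  -- Interchange the two rectangles before cutting; the result is the cut at `j` up to labels.
  rw [← cl_mul_cl _ ((D.reindex (Equiv.swap k j)).cutAt k d), cl_cutAt,
    cl_reindex_self D d, one_mul]
  refine cl_eq_one_of_eq_reindex d (Equiv.swap k j).optionCongr (Dissection.ext (funext fun o => ?_))
  rcases o with _ | m
  · simp [reindex, cutAt, cutWords, Equiv.swap_apply_def]
  · by_cases h1 : m = k
    · subst h1
      by_cases h2 : m = j
      · subst h2; simp [reindex, cutAt, cutWords]
      · simp [reindex, cutAt, cutWords, Equiv.swap_apply_def, h2, Ne.symm h2]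
    · by_cases h2 : m = j
      · subst h2; simp [reindex, cutAt, cutWords]
      · simp [reindex, cutAt, cutWords, Equiv.swap_apply_def, h1, h2]

theorem cl_cutAt_cutAt_same (D E : Dissection ι κ) (k j : κ) (d : ι) :
    cl (D.cutAt k d) (E.cutAt j d) = cl D E := by
  rw [← cl_mul_cl _ (D.cutAt j d), cl_cutAt_cutAt, one_mul, cl_cutAt]

/-- The class of a change of direction of a cut does not depend on the rectangle. -/
theorem cl_turn_eq (D E : Dissection ι κ) (k j : κ) (d d' : ι) :
    cl (D.cutAt k d) (D.cutAt k d') = cl (E.cutAt j d) (E.cutAt j d') := by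
  rw [← cl_mul_cl _ (E.cutAt j d) (D.cutAt k d'), ← cl_mul_cl _ (E.cutAt j d') (D.cutAt k d'),
    cl_cutAt_cutAt_same, cl_cutAt_cutAt_same, mul_left_comm, cl_mul_cl, cl_self, mul_one]

theorem cl_cutAt_comm (D : Dissection ι κ) {k j : κ} (h : k ≠ j) (d d' : ι) :
    cl ((D.cutAt k d).cutAt (some j) d') ((D.cutAt j d').cutAt (some k) d) = 1 := by
  classical
  -- The rectangles agree; only the two upper halves are labelled in the opposite order.
  refine cl_eq_one_of_eq_reindex d (Equiv.swap none (some none))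
    (Dissection.ext (funext fun o => ?_))
  rcases o with _ | _ | m
  · simp [reindex, cutAt, cutWords, h]
  · simp [reindex, cutAt, cutWords, h.symm]
  · by_cases h1 : m = k
    · subst h1; simp [reindex, cutAt, cutWords, h, Equiv.swap_apply_def]
    · by_cases h2 : m = j
      · subst h2; simp [reindex, cutAt, cutWords, h.symm, Equiv.swap_apply_def]
      · simp [reindex, cutAt, cutWords, Equiv.swap_apply_def, h1, h2]

/-- The class of a change of direction does not depend on the number of rectangles. -/
theorem cl_turn_succ [Nontrivial κ] (D : Dissection ι κ) (E : Dissection ι (Option κ)) (k : κ)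
    (m : Option κ) (d d' : ι) :
    cl (D.cutAt k d) (D.cutAt k d') = cl (E.cutAt m d) (E.cutAt m d') := by
  obtain ⟨j, hj⟩ := exists_ne k
  -- The extra rectangle comes from cutting some `j ≠ k`, which commutes with either cut of `k`;
  -- with a single rectangle there is no such `j`.
  rw [cl_turn_eq E (D.cutAt j d) m (some k), ← cl_cutAt _ _ (some j) d,
    ← cl_mul_cl _ ((D.cutAt j d).cutAt (some k) d), cl_cutAt_comm D hj.symm, one_mul,
    ← cl_mul_cl _ ((D.cutAt j d).cutAt (some k) d') ((D.cutAt k d').cutAt _ _),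
    cl_cutAt_comm D hj, mul_one]

/-- Cutting in one direction and then both halves in another one is symmetric. -/
theorem cl_cross (D : Dissection ι κ) (k : κ) {d d' : ι} (h : d ≠ d') :
    cl (((D.cutAt k d).cutAt (some k) d').cutAt (some none) d')
      (((D.cutAt k d').cutAt (some k) d).cutAt (some none) d) = 1 := by
  classical
  -- Only the labels of the two mixed quarters (lower in one direction, upper in the other) differ.
  refine cl_eq_one_of_eq_reindex d (Equiv.swap (some none) (some (some none)))
    (Dissection.ext (funext fun o => ?_))
  rcases o with _ | _ | _ | m
  · simp [reindex, cutAt, cutWords, Equiv.swap_apply_def, extendWord_comm h]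
  · simp [reindex, cutAt, cutWords, Equiv.swap_apply_def, extendWord_comm h]
  · simp [reindex, cutAt, cutWords, Equiv.swap_apply_def, extendWord_comm h]
  · by_cases h1 : m = k
    · subst h1
      simp [reindex, cutAt, cutWords, Equiv.swap_apply_def, extendWord_comm h]
    · simp [reindex, cutAt, cutWords, Equiv.swap_apply_def, h1]

/-- Passing from one quartering to the other turns the first cut from `d` to `d'` and then turns
each of the two later cuts back. The last turn happens with one rectangle more, which does not
matter by `cl_turn_succ`. -/
theorem cl_turn_eq_mul (D : Dissection ι κ) (E : Dissection ι (Option κ)) (k : κ)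
    (m : Option κ) {d d' : ι} (h : d ≠ d') :
    cl (D.cutAt k d) (D.cutAt k d') =
      cl (E.cutAt m d) (E.cutAt m d') * cl (E.cutAt m d) (E.cutAt m d') := by
  have h1 := cl_cross D k h
  have : Nontrivial (Option κ) := ⟨⟨none, some k, by simp⟩⟩
  rw [← cl_mul_cl _ (((D.cutAt k d').cutAt (some k) d').cutAt (some none) d'), cl_cutAt, cl_cutAt,
    ← cl_mul_cl _ (((D.cutAt k d').cutAt (some k) d).cutAt (some none) d'), cl_cutAt,
    cl_turn_eq (D.cutAt k d') E (some k) m d' d,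
    ← cl_turn_succ E ((D.cutAt k d').cutAt (some k) d) m (some none) d' d] at h1
  have h2 : cl (E.cutAt m d') (E.cutAt m d) * cl (E.cutAt m d) (E.cutAt m d') = 1 := by
    rw [cl_mul_cl, cl_self]
  rw [eq_inv_of_mul_eq_one_left h2, ← mul_inv, mul_inv_eq_one] at h1
  exact h1

/-- With at least two rectangles the class is independent of their number, so the squaring relation
says that it equals its own square. -/
theorem cl_turn_nontrivial [Nontrivial κ] (D : Dissection ι κ) (k : κ) (d d' : ι) :
    cl (D.cutAt k d) (D.cutAt k d') = 1 := by
  rcases eq_or_ne d d' with rfl | h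
  · exact cl_self _
  · have h1 := cl_turn_eq_mul D (D.cutAt k d) k none h
    rw [← cl_turn_succ D (D.cutAt k d) k none] at h1
    exact left_eq_mul.1 h1

theorem cl_turn (D : Dissection ι κ) (k : κ) (d d' : ι) :
    cl (D.cutAt k d) (D.cutAt k d') = 1 := by
  rcases eq_or_ne d d' with rfl | h
  · exact cl_self _
  · have : Nontrivial (Option κ) := ⟨⟨none, some k, by simp⟩⟩
    rw [cl_turn_eq_mul D (D.cutAt k d) k none h, cl_turn_nontrivial, one_mul]

/-! ### Triviality of all classes, and perfectness -/

theorem cl_eq_one (D E : Dissection ι κ) : cl D E = 1 := by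
  obtain ⟨n, hn⟩ : ∃ n, Nat.card κ = n := ⟨_, rfl⟩
  induction n generalizing κ with
  | zero =>
    -- The cube has a point, so a dissection has at least one rectangle.
    obtain ⟨x⟩ : Nonempty κ := by
      obtain ⟨s, -⟩ := D.bijective_place.2 fun _ _ => false
      exact ⟨s.1⟩
    have := D.finite
    have : Nonempty κ := ⟨x⟩
    exact absurd hn Nat.card_pos.ne'
  | succ n ih =>
    rcases D.eq_unit_or_cutAt with ⟨hs, hD⟩ | ⟨μ, e, D', m, d, rfl⟩ <;>
      rcases E.eq_unit_or_cutAt with ⟨hs', hE⟩ | ⟨ν, e', E', m', d', rfl⟩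
    · rw [Dissection.ext (hD.trans hE.symm), cl_self]
    · exact absurd (@Equiv.subsingleton _ _ e'.symm hs) (not_subsingleton_iff_nontrivial.2
        ⟨⟨none, some m', by simp⟩⟩)
    · exact absurd (@Equiv.subsingleton _ _ e.symm hs') (not_subsingleton_iff_nontrivial.2
        ⟨⟨none, some m, by simp⟩⟩)
    · have := D'.finite
      have := E'.finite
      have hμ : Nat.card μ = n := by
        rw [Nat.card_congr e, Finite.card_option] at hn; omega
      have hν : Nat.card ν = n := by
        rw [Nat.card_congr e', Finite.card_option] at hn; omega
      obtain ⟨τ⟩ : Nonempty (μ ≃ ν) := ⟨(Finite.equivFinOfCardEq hμ).trans (Finite.equivFinOfCardEq hν).symm⟩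
      -- Turn the last cut of `D'` to direction `d'`, then replace `D'` by `E'` labelled via `τ`, by
      -- induction. What remains is to move the cut from `τ m` to `m'` and to relabel.
      rw [← cl_mul_cl _ (((E'.reindex τ).cutAt m d').reindex e), cl_reindex,
        ← cl_mul_cl _ (D'.cutAt m d'), cl_turn, cl_cutAt, ih _ _ hμ, one_mul, one_mul]
      have h1 : ((E'.reindex τ).cutAt m d').reindex e =
          ((E'.cutAt (τ m) d').reindex τ.optionCongr).reindex e := by
        refine Dissection.ext (funext fun k => ?_)
        rcases h : e k with _ | j
        · simp [reindex, cutAt, cutWords, h]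
        · by_cases hj : j = m <;> simp [reindex, cutAt, cutWords, h, hj]
      rw [h1, reindex_reindex]
      set ρ := e.trans τ.optionCongr
      rw [← cl_mul_cl _ ((E'.cutAt m' d').reindex ρ), cl_reindex, cl_cutAt_cutAt, one_mul]
      refine cl_eq_one_of_eq_reindex d (e'.trans ρ.symm) ?_
      rw [reindex_reindex, Equiv.trans_assoc, Equiv.symm_trans_self, Equiv.trans_refl]

end Dissection

theorem commutator_patternGroup (ι : Type) [DecidableEq ι] :
    commutator (patternGroup ι) = ⊤ := by
  rw [← Abelianization.ker_of, eq_top_iff]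
  rintro ⟨f, P, Q, e, h⟩ -
  set D := Dissection.ofPattern P
  -- The bijection `e` labels the rectangles of `Q` by those of `P`.
  set E := (Dissection.ofPattern Q).reindex e
  have hf : Dissection.Carries f D E := h
  rw [MonoidHom.mem_ker, hf.eq_carry (f := ⟨f, P, Q, e, h⟩)]
  exact Dissection.cl_eq_one D E

/-- The inclusion of `nV` in `ωV`. -/
noncomputable def stabilizeHom (n : ℕ) : nV n →* omegaV where
  toFun f := ⟨stabilize n f, n, f, f.2, rfl⟩
  map_one' := Subtype.ext (extendHomeo_one _)
  map_mul' _ _ := Subtype.ext (extendHomeo_mul _ _ _)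

/-- Each element comes from some `nV n`, where it is a product of commutators; homomorphisms
preserve such products. -/
theorem commutator_omegaV : commutator omegaV = ⊤ := by
  rw [eq_top_iff]
  rintro ⟨_, n, f, hf, rfl⟩ -
  have h : (⟨f, hf⟩ : nV n) ∈ commutator (nV n) := by
    rw [show commutator (nV n) = ⊤ from commutator_patternGroup (Fin n)]
    exact Subgroup.mem_top _
  have h1 := Subgroup.mem_map_of_mem (stabilizeHom n) h
  rw [commutator_def, Subgroup.map_commutator] at h1
  exact Subgroup.commutator_mono le_top le_top h1

end HigherThompson

theorem mainTheorem6 :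
    (∀ n : ℕ, commutator (HigherThompson.nV n) = ⊤) ∧
      commutator HigherThompson.omegaV = ⊤ :=
  ⟨fun n => HigherThompson.commutator_patternGroup (Fin n), HigherThompson.commutator_omegaV⟩
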